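/- Let $\Gamma$ be a countable discrete group with identity $e$ and let $\sigma : \Gamma \times \Gamma \to \mathbb{T}$ be a cocycle, i.e., $\sigma(x,yz)\sigma(y,z) = \sigma(xy,z)\sigma(x,y)$ and $\sigma(x,e)=\sigma(e,x)=1$ for all $x,y,z \in \Gamma$. Let $\pi$ be a $\sigma$-representation of $\Gamma$ on a separable complex Hilbert space $\mathcal{H}_\pi$, i.e., a map $\pi : \Gamma \to \mathcal{U}(\mathcal{H}_\pi)$ with $\pi(e)=I$ and $\pi(x)\pi(y)=\sigma(x,y)\pi(xy)$ for all $x,y\in\Gamma$. Assume that $\pi$ is square-integrable: there is a norm dense subspace $\mathcal{D}\subseteq\mathcal{H}_\pi$ such that $(\langle f,\pi(\gamma)g\rangle)_{\gamma\in\Gamma} \in \ell^2(\Gamma)$ for all $f\in\mathcal{H}_\pi$ and $g\in\mathcal{D}$. Suppose that $(\Gamma,\sigma)$ satisfies Kleppner's condition: if $\gamma_0\in\Gamma\setminus\{e\}$ satisfies $\sigma(\gamma_0,\gamma)=\sigma(\gamma,\gamma_0)$ for all $\gamma\in\Gamma$ commuting with $\gamma_0$, then its conjugacy class $\{\gamma\gamma_0\gamma^{-1}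 : \gamma\in\Gamma\}$ is infinite. Then at least one of the following holds (possibly both): (a) $\pi$ admits a cyclic vector, i.e., there is $g\in\mathcal{H}_\pi$ such that the closed linear span of $\{\pi(\gamma)g : \gamma\in\Gamma\}$ is $\mathcal{H}_\pi$; (b) the double commutant $\pi(\Gamma)''$ of $\pi(\Gamma)$ in $\mathcal{B}(\mathcal{H}_\pi)$ admits a separating vector, i.e., there is $g\in\mathcal{H}_\pi$ such that $T\in\pi(\Gamma)''$ and $Tg=0$ imply $T=0$. -/

import Mathlib

/-- A cocycle (multiplier) on a discrete group `Γ` with values in the circle group.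
Borel measurability is automatic because `Γ` is discrete. -/
structure Multiplier (Γ : Type*) [Group Γ] where
  /-- the underlying map `Γ × Γ → 𝕋` -/
  toFun : Γ → Γ → Circle
  cocycle : ∀ x y z : Γ, toFun x (y * z) * toFun y z = toFun (x * y) z * toFun x y
  map_one_right : ∀ x : Γ, toFun x 1 = 1
  map_one_left : ∀ x : Γ, toFun 1 x = 1

instance Multiplier.instCoeFun {Γ : Type*} [Group Γ] :
    CoeFun (Multiplier Γ) (fun _ => Γ → Γ → Circle) := ⟨Multiplier.toFun⟩

/-- An element `γ₀` is `σ`-regular if `σ(γ₀, γ) = σ(γ, γ₀)` for every `γ` commuting with `γ₀`. -/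
def Multiplier.IsRegularElement {Γ : Type*} [Group Γ] (σ : Multiplier Γ) (γ₀ : Γ) : Prop :=
  ∀ γ : Γ, Commute γ₀ γ → σ γ₀ γ = σ γ γ₀

/-- Kleppner's condition: every `σ`-regular element other than the identity has an infinite
conjugacy class. -/
def Multiplier.KleppnerCondition {Γ : Type*} [Group Γ] (σ : Multiplier Γ) : Prop :=
  ∀ γ₀ : Γ, γ₀ ≠ 1 → σ.IsRegularElement γ₀ →
    (Set.range fun γ : Γ => γ * γ₀ * γ⁻¹).Infinite

/-- A projective unitary representation of the discrete group `Γ` on the Hilbert space `H` with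
cocycle `σ`. Weak measurability is automatic because `Γ` is discrete. -/
structure SigmaRep {Γ : Type*} [Group Γ] (σ : Multiplier Γ)
    (H : Type*) [NormedAddCommGroup H] [InnerProductSpace ℂ H] [CompleteSpace H] where
  /-- the underlying map into the unitary operators -/
  toFun : Γ → unitary (H →L[ℂ] H)
  map_mul : ∀ x y : Γ, (toFun x : H →L[ℂ] H) * (toFun y : H →L[ℂ] H) =
    (σ x y : ℂ) • (toFun (x * y) : H →L[ℂ] H)
  map_one : toFun 1 = 1

namespace SigmaRep

/-- The operator `π(γ)`. -/
def op {Γ : Type*} [Group Γ] {σ : Multiplier Γ}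
    {H : Type*} [NormedAddCommGroup H] [InnerProductSpace ℂ H] [CompleteSpace H]
    (π : SigmaRep σ H) (γ : Γ) : H →L[ℂ] H := (π.toFun γ : H →L[ℂ] H)

/-- The matrix coefficient `C_g f (γ) = ⟨f, π(γ) g⟩`, for an inner product that is linear in the
first argument; Mathlib's `inner` is linear in the second one. -/
noncomputable def matrixCoeff {Γ : Type*} [Group Γ] {σ : Multiplier Γ}
    {H : Type*} [NormedAddCommGroup H] [InnerProductSpace ℂ H] [CompleteSpace H]
    (π : SigmaRep σ H) (g f : H) (γ : Γ) : ℂ := inner ℂ (π.op γ g) f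

/-- Square-integrability: there is a norm dense subspace `D` of `H` such that `C_g f ∈ ℓ²(Γ)` for
all `f ∈ H` and `g ∈ D`. -/
def SquareIntegrable {Γ : Type*} [Group Γ] {σ : Multiplier Γ}
    {H : Type*} [NormedAddCommGroup H] [InnerProductSpace ℂ H] [CompleteSpace H]
    (π : SigmaRep σ H) : Prop :=
  ∃ D : Submodule ℂ H, Dense (D : Set H) ∧
    ∀ f : H, ∀ g ∈ D, Memℓp (π.matrixCoeff g f) 2

/-- The vector `g` is cyclic for `π`: the closed linear span of the orbit `π(Γ)g` is `H`. -/
def IsCyclicVector {Γ : Type*} [Group Γ] {σ : Multiplier Γ}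
    {H : Type*} [NormedAddCommGroup H] [InnerProductSpace ℂ H] [CompleteSpace H]
    (π : SigmaRep σ H) (g : H) : Prop :=
  (Submodule.span ℂ (Set.range fun γ : Γ => π.op γ g)).topologicalClosure = ⊤

/-- The double commutant `π(Γ)''` in the bounded operators on `H`. -/
def bicommutant {Γ : Type*} [Group Γ] {σ : Multiplier Γ}
    {H : Type*} [NormedAddCommGroup H] [InnerProductSpace ℂ H] [CompleteSpace H]
    (π : SigmaRep σ H) : Set (H →L[ℂ] H) :=
  Set.centralizer (Set.centralizer (Set.range π.op))

end SigmaRep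

/-- The vector `g` is separating for a family `M` of bounded operators: `T ∈ M` and `T g = 0`
imply `T = 0`. -/
def IsSeparatingVector {H : Type*} [NormedAddCommGroup H] [InnerProductSpace ℂ H]
    (M : Set (H →L[ℂ] H)) (g : H) : Prop :=
  ∀ T ∈ M, T g = 0 → T = 0

open ContinuousLinearMap

/-- The square root of `T†T` has the same norm as `T` at every vector. -/
theorem norm_sqrt_adjoint_comp_self_apply {H₁ H₂ : Type*}
    [NormedAddCommGroup H₁] [InnerProductSpace ℂ H₁] [CompleteSpace H₁]
    [NormedAddCommGroup H₂] [InnerProductSpace ℂ H₂] [CompleteSpace H₂]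
    (T : H₁ →L[ℂ] H₂) (x : H₁) : ‖CFC.sqrt (adjoint T ∘L T) x‖ = ‖T x‖ := by
  have hpos : (0 : H₁ →L[ℂ] H₁) ≤ adjoint T ∘L T := by
    rw [nonneg_iff_isPositive]
    exact isPositive_adjoint_comp_self T
  have hsa : adjoint (CFC.sqrt (adjoint T ∘L T)) = CFC.sqrt (adjoint T ∘L T) :=
    (IsSelfAdjoint.of_nonneg (CFC.sqrt_nonneg (adjoint T ∘L T))).adjoint_eq
  have hsq : CFC.sqrt (adjoint T ∘L T) (CFC.sqrt (adjoint T ∘L T) x) = adjoint T (T x) :=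
    congrArg (fun R : H₁ →L[ℂ] H₁ => R x) (CFC.sqrt_mul_sqrt_self (adjoint T ∘L T) hpos)
  have h : inner ℂ (CFC.sqrt (adjoint T ∘L T) x) (CFC.sqrt (adjoint T ∘L T) x) =
      inner ℂ (T x) (T x) := by
    rw [← adjoint_inner_right, hsa, hsq, adjoint_inner_right]
  rw [inner_self_eq_norm_sq_to_K, inner_self_eq_norm_sq_to_K] at h
  exact (sq_eq_sq₀ (norm_nonneg _) (norm_nonneg _)).mp (by exact_mod_cast h)

/-! ### Invariant subspaces and intertwiners -/

namespace SigmaRep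

variable {Γ : Type*} [Group Γ] {σ : Multiplier Γ}
  {H : Type*} [NormedAddCommGroup H] [InnerProductSpace ℂ H] [CompleteSpace H]
  {H₁ : Type*} [NormedAddCommGroup H₁] [InnerProductSpace ℂ H₁] [CompleteSpace H₁]
  {H₂ : Type*} [NormedAddCommGroup H₂] [InnerProductSpace ℂ H₂] [CompleteSpace H₂]
  {H₃ : Type*} [NormedAddCommGroup H₃] [InnerProductSpace ℂ H₃] [CompleteSpace H₃]

theorem op_op (π : SigmaRep σ H) (a b : Γ) (x : H) :
    π.op a (π.op b x) = (σ a b : ℂ) • π.op (a * b) x :=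
  congrArg (fun T : H →L[ℂ] H => T x) (π.map_mul a b)

theorem op_one (π : SigmaRep σ H) (x : H) : π.op 1 x = x := by
  simp [op, π.map_one]

theorem inner_op_op (π : SigmaRep σ H) (a : Γ) (x y : H) :
    inner ℂ (π.op a x) (π.op a y) = inner ℂ x y :=
  Unitary.inner_map_map (π.toFun a) x y

theorem op_op_inv (π : SigmaRep σ H) (a : Γ) (x : H) :
    π.op a (((σ a a⁻¹)⁻¹ : Circle) • π.op a⁻¹ x) = x := by
  rw [Circle.smul_def, map_smul, op_op, smul_smul, mul_inv_cancel, op_one]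
  simp

theorem inner_op_left (π : SigmaRep σ H) (a : Γ) (x y : H) :
    inner ℂ (π.op a x) y = (((σ a a⁻¹)⁻¹ : Circle) : ℂ) * inner ℂ x (π.op a⁻¹ y) := by
  conv_lhs => rw [← π.op_op_inv a y]
  rw [inner_op_op, Circle.smul_def, inner_smul_right]

/-- A submodule is invariant if it is mapped into itself by all operators `π(γ)`. -/
def Invariant (π : SigmaRep σ H) (A : Submodule ℂ H) : Prop :=
  ∀ γ : Γ, ∀ x ∈ A, π.op γ x ∈ A

theorem Invariant.orthogonal {π : SigmaRep σ H} {A : Submodule ℂ H} (hA : π.Invariant A) :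
    π.Invariant Aᗮ := by
  intro γ x hx
  rw [Submodule.mem_orthogonal'] at hx ⊢
  intro u hu
  rw [inner_op_left, hx _ (hA _ _ hu), mul_zero]

/-- A bounded operator intertwines two representations. -/
def Intertwines (π₁ : SigmaRep σ H₁) (π₂ : SigmaRep σ H₂) (T : H₁ →L[ℂ] H₂) : Prop :=
  ∀ γ : Γ, ∀ x : H₁, T (π₁.op γ x) = π₂.op γ (T x)

variable {π : SigmaRep σ H} {π₁ : SigmaRep σ H₁} {π₂ : SigmaRep σ H₂} {π₃ : SigmaRep σ H₃}

theorem Intertwines.comp {S : H₂ →L[ℂ] H₃} {T : H₁ →L[ℂ] H₂} (hS : Intertwines π₂ π₃ S)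
    (hT : Intertwines π₁ π₂ T) : Intertwines π₁ π₃ (S ∘L T) := fun γ x => by
  rw [comp_apply, hT, hS, comp_apply]

theorem Intertwines.adjoint {T : H₁ →L[ℂ] H₂} (hT : Intertwines π₁ π₂ T) :
    Intertwines π₂ π₁ (adjoint T) := fun γ x => by
  refine ext_inner_right ℂ fun y => ?_
  rw [adjoint_inner_left, inner_op_left, inner_op_left, adjoint_inner_left, hT]

theorem Intertwines.mem_centralizer {T : H →L[ℂ] H} (hT : Intertwines π π T) :
    T ∈ Set.centralizer (Set.range π.op) := by
  rintro _ ⟨γ, rfl⟩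
  ext x
  exact (hT γ x).symm

theorem Intertwines.starProjection {A : Submodule ℂ H} [A.HasOrthogonalProjection]
    (hA : π.Invariant A) : Intertwines π π A.starProjection := fun γ x => by
  refine Submodule.eq_starProjection_of_mem_of_inner_eq_zero
    (hA γ _ (A.starProjection_apply_mem x)) fun w hw => ?_
  rw [← map_sub, inner_eq_zero_symm]
  exact (Submodule.mem_orthogonal _ _).mp
    (hA.orthogonal γ _ (A.sub_starProjection_mem_orthogonal x)) w hw

/-- `T†T` commutes with every `π₁(γ)`, and commutation passes to the functional calculus. -/
theorem Intertwines.sqrt {T : H₁ →L[ℂ] H₂} (hT : Intertwines π₁ π₂ T) :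
    Intertwines π₁ π₁ (CFC.sqrt (ContinuousLinearMap.adjoint T ∘L T)) := fun γ x => by
  have h : Commute (ContinuousLinearMap.adjoint T ∘L T) (π₁.op γ) := by
    ext y
    exact hT.adjoint.comp hT γ y
  exact congrArg (fun S : H₁ →L[ℂ] H₁ => S x) (h.cfcₙ_nnreal NNReal.sqrt).eq

/-! ### Comparison of representations -/

/-- A submodule of `H₁ × H₂` is a partial equivalence of the representations `π₁` and `π₂` if it is
the graph of an isometric equivariant map between submodules. -/
structure IsPartialEquiv (π₁ : SigmaRep σ H₁) (π₂ : SigmaRep σ H₂)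
    (G : Submodule ℂ (H₁ × H₂)) : Prop where
  norm_eq : ∀ p ∈ G, ‖p.1‖ = ‖p.2‖
  map_mem : ∀ γ : Γ, ∀ p ∈ G, (π₁.op γ p.1, π₂.op γ p.2) ∈ G

theorem IsPartialEquiv.topologicalClosure {G : Submodule ℂ (H₁ × H₂)}
    (hG : IsPartialEquiv π₁ π₂ G) : IsPartialEquiv π₁ π₂ G.topologicalClosure where
  norm_eq p hp := by
    have hc : IsClosed {p : H₁ × H₂ | ‖p.1‖ = ‖p.2‖} :=
      isClosed_eq (by fun_prop) (by fun_prop)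
    exact closure_minimal (s := (G : Set (H₁ × H₂))) (fun q hq => hG.norm_eq q hq) hc hp
  map_mem γ p hp :=
    map_mem_closure (f := fun q : H₁ × H₂ => (π₁.op γ q.1, π₂.op γ q.2))
      (by fun_prop) (s := (G : Set (H₁ × H₂))) hp (fun q hq => hG.map_mem γ q hq)

theorem IsPartialEquiv.swap {G : Submodule ℂ (H₁ × H₂)} (hG : IsPartialEquiv π₁ π₂ G) :
    IsPartialEquiv π₂ π₁ (G.map (LinearEquiv.prodComm ℂ H₁ H₂).toLinearMap) where
  norm_eq := by
    rintro _ ⟨p, hp, rfl⟩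
    exact (hG.norm_eq p hp).symm
  map_mem := by
    rintro γ _ ⟨p, hp, rfl⟩
    exact ⟨_, hG.map_mem γ p hp, rfl⟩

theorem IsPartialEquiv.invariant_fst {G : Submodule ℂ (H₁ × H₂)}
    (hG : IsPartialEquiv π₁ π₂ G) : π₁.Invariant (G.map (LinearMap.fst ℂ H₁ H₂)) := by
  rintro γ _ ⟨p, hp, rfl⟩
  exact ⟨_, hG.map_mem γ p hp, rfl⟩

theorem IsPartialEquiv.invariant_snd {G : Submodule ℂ (H₁ × H₂)}
    (hG : IsPartialEquiv π₁ π₂ G) : π₂.Invariant (G.map (LinearMap.snd ℂ H₁ H₂)) := by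
  rintro γ _ ⟨p, hp, rfl⟩
  exact ⟨_, hG.map_mem γ p hp, rfl⟩

/-- A closed partial equivalence whose domain is dense is the graph of an equivariant isometry. -/
theorem IsPartialEquiv.exists_isometry {G : Submodule ℂ (H₁ × H₂)}
    (hG : IsPartialEquiv π₁ π₂ G) (hc : IsClosed (G : Set (H₁ × H₂)))
    (hd : (G.map (LinearMap.fst ℂ H₁ H₂))ᗮ = ⊥) :
    ∃ V : H₁ →ₗᵢ[ℂ] H₂, Intertwines π₁ π₂ V.toContinuousLinearMap := by
  -- The product carries the sup norm and both coordinates have equal norm on `G`, so the first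
  -- projection is isometric; completeness of `G` then makes its range closed.
  let f : G →ₗᵢ[ℂ] H₁ :=
    { toLinearMap := LinearMap.fst ℂ H₁ H₂ ∘ₗ G.subtype
      norm_map' := fun p => by
        change ‖p.1.1‖ = ‖p.1‖
        rw [Prod.norm_def, ← hG.norm_eq p p.2, max_self] }
  have : CompleteSpace G := hc.completeSpace_coe
  have hrange : LinearMap.range f.toLinearMap = G.map (LinearMap.fst ℂ H₁ H₂) := by
    simp [f, LinearMap.range_comp]
  have hclosed : IsClosed ((LinearMap.range f.toLinearMap : Submodule ℂ H₁) : Set H₁) := by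
    have := f.isometry.isClosedEmbedding.isClosed_range
    simpa [LinearMap.coe_range] using this
  have htop : LinearMap.range f.toLinearMap = ⊤ := by
    rw [← hclosed.submodule_topologicalClosure_eq, Submodule.topologicalClosure_eq_top_iff, hrange,
      hd]
  let e : G ≃ₗᵢ[ℂ] H₁ := LinearIsometryEquiv.ofSurjective f (LinearMap.range_eq_top.mp htop)
  have he : ∀ x, (e.symm x).1.1 = x := fun x => e.apply_symm_apply x
  refine ⟨{ toLinearMap := LinearMap.snd ℂ H₁ H₂ ∘ₗ G.subtype ∘ₗ e.symm.toLinearEquiv.toLinearMap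
            norm_map' := fun x => ?_ }, fun γ x => ?_⟩
  · change ‖(e.symm x).1.2‖ = ‖x‖
    rw [← hG.norm_eq _ (e.symm x).2, he]
  · change (e.symm (π₁.op γ x)).1.2 = π₂.op γ (e.symm x).1.2
    have h := hG.map_mem γ _ (e.symm x).2
    rw [he] at h
    -- Two points of `G` with the same first coordinate differ by a pair whose second coordinate
    -- must have norm zero.
    have h2 := hG.norm_eq _ (G.sub_mem (e.symm (π₁.op γ x)).2 h)
    simp only [Prod.fst_sub, Prod.snd_sub, he, sub_self, norm_zero] at h2
    exact sub_eq_zero.mp (norm_eq_zero.mp h2.symm)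

/-- A nonzero intertwiner between the orthogonal complements of the domain and the range of a
partial equivalence yields a proper extension. -/
theorem IsPartialEquiv.sup {G : Submodule ℂ (H₁ × H₂)} (hG : IsPartialEquiv π₁ π₂ G)
    {T : H₁ →L[ℂ] H₂} (hT : Intertwines π₁ π₂ T)
    (hker : ∀ x ∈ G.map (LinearMap.fst ℂ H₁ H₂), T x = 0)
    (hran : ∀ x, T x ∈ (G.map (LinearMap.snd ℂ H₁ H₂))ᗮ) :
    IsPartialEquiv π₁ π₂
      (G ⊔ LinearMap.range ((CFC.sqrt (ContinuousLinearMap.adjoint T ∘L T)).prod T).toLinearMap) ∧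
    (LinearMap.range ((CFC.sqrt (ContinuousLinearMap.adjoint T ∘L T)).prod T).toLinearMap ≤ G →
      T = 0) := by
  -- Polar decomposition: `S x ↦ T x` is an equivariant isometry, orthogonal to `G` in both
  -- coordinates, so Pythagoras lets the graphs be added.
  set S := CFC.sqrt (ContinuousLinearMap.adjoint T ∘L T) with hS
  have hnorm : ∀ x, ‖S x‖ = ‖T x‖ := norm_sqrt_adjoint_comp_self_apply T
  have hsa : ContinuousLinearMap.adjoint S = S :=
    (IsSelfAdjoint.of_nonneg (CFC.sqrt_nonneg _)).adjoint_eq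
  have hSker : ∀ p ∈ G, S p.1 = 0 := fun p hp => by
    rw [← norm_eq_zero, hnorm, norm_eq_zero]
    exact hker _ ⟨p, hp, rfl⟩
  have horth₁ : ∀ p ∈ G, ∀ x, inner ℂ p.1 (S x) = 0 := fun p hp x => by
    rw [← adjoint_inner_left, hsa, hSker p hp, inner_zero_left]
  have horth₂ : ∀ p ∈ G, ∀ x, inner ℂ p.2 (T x) = 0 := fun p hp x =>
    (Submodule.mem_orthogonal _ _).mp (hran x) _ ⟨p, hp, rfl⟩
  refine ⟨⟨fun p hp => ?_, fun γ p hp => ?_⟩, fun hle => ?_⟩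
  · obtain ⟨q, hq, _, ⟨x, rfl⟩, rfl⟩ := Submodule.mem_sup.mp hp
    change ‖q.1 + S x‖ = ‖q.2 + T x‖
    rw [← sq_eq_sq₀ (norm_nonneg _) (norm_nonneg _), sq, sq,
      norm_add_sq_eq_norm_sq_add_norm_sq_of_inner_eq_zero (𝕜 := ℂ) _ _ (horth₁ q hq x),
      norm_add_sq_eq_norm_sq_add_norm_sq_of_inner_eq_zero (𝕜 := ℂ) _ _ (horth₂ q hq x),
      hnorm, hG.norm_eq q hq]
  · obtain ⟨q, hq, _, ⟨x, rfl⟩, rfl⟩ := Submodule.mem_sup.mp hp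
    refine Submodule.mem_sup.mpr ⟨_, hG.map_mem γ q hq, _, ⟨π₁.op γ x, rfl⟩, ?_⟩
    change (π₁.op γ q.1 + S (π₁.op γ x), π₂.op γ q.2 + T (π₁.op γ x)) =
      (π₁.op γ (q.1 + S x), π₂.op γ (q.2 + T x))
    rw [hT.sqrt, hT, map_add, map_add]
  · ext x
    -- If `(S x, T x)` lies in `G`, then `T x` is orthogonal to itself.
    have h := horth₂ _ (hle ⟨x, rfl⟩) x
    exact inner_self_eq_zero.mp h

/-- Comparison: if any two proper invariant submodules leave room for a nonzero intertwiner between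
their orthogonal complements, one of the representations embeds isometrically into the other. -/
theorem exists_isometry_or_exists_isometry (π₁ : SigmaRep σ H₁) (π₂ : SigmaRep σ H₂)
    (h : ∀ (A : Submodule ℂ H₁) (B : Submodule ℂ H₂), π₁.Invariant A → π₂.Invariant B →
      Aᗮ ≠ ⊥ → Bᗮ ≠ ⊥ → ∃ T : H₁ →L[ℂ] H₂, Intertwines π₁ π₂ T ∧ T ≠ 0 ∧
        (∀ x ∈ A, T x = 0) ∧ ∀ x, T x ∈ Bᗮ) :
    (∃ V : H₁ →ₗᵢ[ℂ] H₂, Intertwines π₁ π₂ V.toContinuousLinearMap) ∨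
      ∃ W : H₂ →ₗᵢ[ℂ] H₁, Intertwines π₂ π₁ W.toContinuousLinearMap := by
  obtain ⟨G, hG, hmax⟩ : ∃ G, Maximal (· ∈ {G | IsPartialEquiv π₁ π₂ G}) G := by
    refine zorn_le₀ _ fun c hc hchain => ?_
    rcases c.eq_empty_or_nonempty with rfl | hne
    · refine ⟨⊥, ⟨?_, ?_⟩, by simp⟩
      · rintro p rfl
        simp
      · rintro γ p rfl
        simp
    · have hmem : ∀ p, p ∈ sSup c ↔ ∃ G ∈ c, p ∈ G := fun p =>
        Submodule.mem_sSup_of_directed hne hchain.directedOn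
      refine ⟨sSup c, ⟨fun p hp => ?_, fun γ p hp => ?_⟩, fun G hG => le_sSup hG⟩
      · obtain ⟨G, hGc, hpG⟩ := (hmem p).mp hp
        exact (hc hGc).norm_eq p hpG
      · obtain ⟨G, hGc, hpG⟩ := (hmem p).mp hp
        exact (hmem _).mpr ⟨G, hGc, (hc hGc).map_mem γ p hpG⟩
  have hclosed : IsClosed (G : Set (H₁ × H₂)) := by
    have hle := hmax hG.topologicalClosure G.le_topologicalClosure
    rw [← le_antisymm hle G.le_topologicalClosure]
    exact G.isClosed_topologicalClosure
  by_cases h₁ : (G.map (LinearMap.fst ℂ H₁ H₂))ᗮ = ⊥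
  · exact Or.inl (hG.exists_isometry hclosed h₁)
  by_cases h₂ : (G.map (LinearMap.snd ℂ H₁ H₂))ᗮ = ⊥
  · refine Or.inr (hG.swap.exists_isometry ?_ ?_)
    · rw [Submodule.map_coe]
      exact (Homeomorph.prodComm H₁ H₂).isClosedMap _ hclosed
    · rw [← Submodule.map_comp]
      exact h₂
  obtain ⟨T, hT, hT0, hker, hran⟩ := h _ _ hG.invariant_fst hG.invariant_snd h₁ h₂
  obtain ⟨hsup, himp⟩ := hG.sup hT hker hran
  exact absurd (himp (le_sup_right.trans (hmax hsup le_sup_left))) hT0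

end SigmaRep

/-! ### Twisted regular representations -/

/-- The unitary operator `ξ ↦ (x ↦ c x * ξ (e x))` on `ℓ²(ι)`. -/
noncomputable def weightedPermutation {ι : Type*} (e : ι ≃ ι) (c : ι → Circle) :
    lp (fun _ : ι => ℂ) 2 ≃ₗᵢ[ℂ] lp (fun _ : ι => ℂ) 2 :=
  have hmem : ∀ (e : ι ≃ ι) (c : ι → Circle) (ξ : lp (fun _ : ι => ℂ) 2),
      Memℓp (fun x => (c x : ℂ) * ξ (e x)) 2 := fun e c ξ => by
    have h := (lp.memℓp ξ).summable (by norm_num)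
    refine memℓp_gen ?_
    simpa [Function.comp_def, Circle.norm_coe] using (e.summable_iff.mpr h)
  { toFun := fun ξ => ⟨fun x => (c x : ℂ) * ξ (e x), hmem e c ξ⟩
    invFun := fun ξ => ⟨fun x => (((c (e.symm x))⁻¹ : Circle) : ℂ) * ξ (e.symm x),
      hmem e.symm (fun x => (c (e.symm x))⁻¹) ξ⟩
    map_add' := fun ξ η => by
      ext x
      exact mul_add _ _ _
    map_smul' := fun a ξ => by
      ext x
      exact mul_left_comm _ _ _
    left_inv := fun ξ => by
      ext x
      simp
    right_inv := fun ξ => by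
      ext x
      simp
    norm_map' := fun ξ => by
      have h2 : 0 < (2 : ENNReal).toReal := by norm_num
      rw [lp.norm_eq_tsum_rpow h2, lp.norm_eq_tsum_rpow h2,
        ← e.tsum_eq fun x => ‖ξ x‖ ^ (2 : ENNReal).toReal]
      simp [Circle.norm_coe] }

namespace Multiplier

variable {Γ : Type*} [Group Γ] (σ : Multiplier Γ)

theorem cocycle_coe (x y z : Γ) :
    (σ x (y * z) : ℂ) * σ y z = σ (x * y) z * σ x y := by
  exact_mod_cast congrArg (fun c : Circle => (c : ℂ)) (σ.cocycle x y z)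

/-- The inverse (complex conjugate) multiplier. -/
noncomputable def conj : Multiplier Γ where
  toFun x y := (σ x y)⁻¹
  cocycle x y z := by rw [← mul_inv, ← mul_inv, σ.cocycle]
  map_one_right x := by rw [σ.map_one_right, inv_one]
  map_one_left x := by rw [σ.map_one_left, inv_one]

/-- The `σ`-twisted left regular representation. -/
noncomputable def leftRegular : SigmaRep σ (lp (fun _ : Γ => ℂ) 2) where
  toFun a := Unitary.linearIsometryEquiv.symm
    (weightedPermutation (Equiv.mulLeft a⁻¹) fun x => σ a (a⁻¹ * x))
  map_mul a b := by
    ext ξ x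
    change (σ a (a⁻¹ * x) : ℂ) * (σ b (b⁻¹ * (a⁻¹ * x)) * ξ (b⁻¹ * (a⁻¹ * x))) =
      σ a b * (σ (a * b) ((a * b)⁻¹ * x) * ξ ((a * b)⁻¹ * x))
    have h := σ.cocycle_coe a b (b⁻¹ * (a⁻¹ * x))
    rw [mul_inv_cancel_left] at h
    rw [mul_inv_rev, mul_assoc b⁻¹, ← mul_assoc, h]
    ring
  map_one := by
    ext ξ x
    change (σ 1 (1⁻¹ * x) : ℂ) * ξ (1⁻¹ * x) = ξ x
    simp [σ.map_one_left]

theorem leftRegular_op_apply (a : Γ) (ξ : lp (fun _ : Γ => ℂ) 2) (x : Γ) :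
    σ.leftRegular.op a ξ x = (σ a (a⁻¹ * x) : ℂ) * ξ (a⁻¹ * x) := rfl

/-- The twisted right regular representation, which commutes with the left regular one. -/
noncomputable def rightRegular : SigmaRep σ.conj (lp (fun _ : Γ => ℂ) 2) where
  toFun a := Unitary.linearIsometryEquiv.symm
    (weightedPermutation (Equiv.mulRight a) fun x => (σ x a)⁻¹)
  map_mul a b := by
    ext ξ x
    change (((σ x a)⁻¹ : Circle) : ℂ) * (((σ (x * a) b)⁻¹ : Circle) * ξ (x * a * b)) =
      ((σ a b)⁻¹ : Circle) * (((σ x (a * b))⁻¹ : Circle) * ξ (x * (a * b)))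
    have h : (σ x a)⁻¹ * (σ (x * a) b)⁻¹ = (σ a b)⁻¹ * (σ x (a * b))⁻¹ := by
      rw [← mul_inv, ← mul_inv, mul_comm, ← σ.cocycle, mul_comm]
    rw [← mul_assoc, ← mul_assoc, ← Circle.coe_mul, h, Circle.coe_mul, mul_assoc x]
  map_one := by
    ext ξ x
    change (((σ x 1)⁻¹ : Circle) : ℂ) * ξ (x * 1) = ξ x
    simp [σ.map_one_right]

theorem rightRegular_op_apply (a : Γ) (ξ : lp (fun _ : Γ => ℂ) 2) (x : Γ) :
    σ.rightRegular.op a ξ x = (((σ x a)⁻¹ : Circle) : ℂ) * ξ (x * a) := rfl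

theorem intertwines_rightRegular (b : Γ) :
    SigmaRep.Intertwines σ.leftRegular σ.leftRegular (σ.rightRegular.op b) := fun a ξ => by
  have h (y : Γ) : (σ y b)⁻¹ * σ a (a⁻¹ * y * b) = σ a (a⁻¹ * y) * (σ (a⁻¹ * y) b)⁻¹ := by
    have h := σ.cocycle a (a⁻¹ * y) b
    rw [mul_inv_cancel_left] at h
    rw [inv_mul_eq_iff_eq_mul, ← mul_assoc, eq_mul_inv_iff_mul_eq]
    exact h
  ext y
  rw [rightRegular_op_apply, leftRegular_op_apply, leftRegular_op_apply, rightRegular_op_apply,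
    ← mul_assoc a⁻¹, ← mul_assoc, ← mul_assoc]
  exact congrArg (fun c : Circle => (c : ℂ) * ξ (a⁻¹ * y * b)) (h y)

open Classical in
/-- The unit vector of `ℓ²(Γ)` at the identity. -/
noncomputable def deltaOne (Γ : Type*) [Group Γ] : lp (fun _ : Γ => ℂ) 2 := lp.single 2 1 1

open Classical in
theorem deltaOne_apply (x : Γ) : deltaOne Γ x = if x = 1 then 1 else 0 := by
  rw [deltaOne, lp.single_apply, Pi.single_apply]

theorem inner_deltaOne (ξ : lp (fun _ : Γ => ℂ) 2) : inner ℂ (deltaOne Γ) ξ = ξ 1 := by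
  classical
  simp [deltaOne, lp.inner_single_left]

/-- The orbit of `δ₁` under `λ` consists of the point masses, which detect every coordinate. -/
theorem inner_leftRegular_deltaOne (a : Γ) (ξ : lp (fun _ : Γ => ℂ) 2) :
    inner ℂ (σ.leftRegular.op a (deltaOne Γ)) ξ = ξ a := by
  rw [SigmaRep.inner_op_left, inner_deltaOne, leftRegular_op_apply, inv_inv, mul_one, ← mul_assoc,
    ← Circle.coe_mul]
  have h := σ.cocycle a a⁻¹ a
  rw [inv_mul_cancel, mul_inv_cancel, σ.map_one_left, σ.map_one_right, one_mul, one_mul] at h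
  rw [h, inv_mul_cancel, Circle.coe_one, one_mul]

/-- `λ(a)ρ(a)` is conjugation up to a phase; at the identity the phase is trivial because `σ(a, a⁻¹)
= σ(a⁻¹, a)`. -/
theorem leftRegular_rightRegular_deltaOne (a : Γ) :
    σ.leftRegular.op a (σ.rightRegular.op a (deltaOne Γ)) = deltaOne Γ := by
  ext y
  rw [leftRegular_op_apply, rightRegular_op_apply, deltaOne_apply, deltaOne_apply]
  have h1 : a⁻¹ * y * a = 1 ↔ y = 1 := by
    constructor
    · intro h
      have : y = a * (a⁻¹ * y * a) * a⁻¹ := by group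
      rw [this, h, mul_one, mul_inv_cancel]
    · rintro rfl
      group
  by_cases hy : y = 1
  · subst hy
    have h := σ.cocycle a a⁻¹ a
    rw [inv_mul_cancel, mul_inv_cancel, σ.map_one_left, σ.map_one_right, one_mul, one_mul] at h
    simp [h]
  · simp [h1, hy]

/-! ### Consequences of Kleppner's condition -/

/-- A vector of `ℓ²(Γ)` that is fixed by all the operators `λ(a)ρ(a)` is supported on the
`σ`-regular elements with finite conjugacy class. -/
theorem KleppnerCondition.eq_zero {σ : Multiplier Γ} (hσ : σ.KleppnerCondition)
    {ξ : lp (fun _ : Γ => ℂ) 2}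
    (hξ : ∀ a, σ.leftRegular.op a (σ.rightRegular.op a ξ) = ξ) {y : Γ} (hy : y ≠ 1) :
    ξ y = 0 := by
  by_contra hne
  have hval : ∀ a z, ((σ a (a⁻¹ * z) : Circle) : ℂ) *
      ((((σ (a⁻¹ * z) a)⁻¹ : Circle) : ℂ) * ξ (a⁻¹ * z * a)) = ξ z := fun a z => by
    conv_rhs => rw [← hξ a]
    rfl
  refine hσ y hy (fun a hya => ?_) ?_
  -- For `a` commuting with `y`, invariance multiplies `ξ y ≠ 0` by a phase, which must be 1; the
  -- cocycle identity turns this into regularity of `y`.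
  · have hx : a⁻¹ * y = y * a⁻¹ := (hya.inv_right.eq).symm
    have h := hval a y
    rw [← mul_assoc, ← Circle.coe_mul, hx, inv_mul_cancel_right] at h
    have h1 : σ a (y * a⁻¹) * (σ (y * a⁻¹) a)⁻¹ = 1 :=
      Circle.coe_eq_one.mp (mul_right_cancel₀ hne (h.trans (one_mul _).symm))
    have h2 := σ.cocycle a (y * a⁻¹) a
    have h3 : a * (y * a⁻¹) = y := by rw [← hx, mul_inv_cancel_left]
    rw [inv_mul_cancel_right, h3, mul_inv_eq_one.mp h1] at h2
    exact (mul_right_cancel h2).symm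
  -- `|ξ|` is a nonzero constant on the conjugacy class, so square-summability makes the class
  -- finite.
  · have hnorm : ∀ z ∈ Set.range fun γ : Γ => γ * y * γ⁻¹, ‖ξ z‖ = ‖ξ y‖ := by
      rintro _ ⟨γ, rfl⟩
      have h := congrArg norm (hval γ (γ * y * γ⁻¹))
      have h1 : γ⁻¹ * (γ * y * γ⁻¹) * γ = y := by group
      rw [h1] at h
      simpa [Circle.norm_coe] using h.symm
    have hs := ((lp.memℓp ξ).summable (by norm_num)).subtype
      (Set.range fun γ : Γ => γ * y * γ⁻¹)
    refine Set.finite_coe_iff.mp (Finite.of_summable_const (b := ‖ξ y‖ ^ (2 : ENNReal).toReal) (by positivity)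
      (hs.congr fun z => ?_))
    simpa using congrArg (· ^ (2 : ENNReal).toReal) (hnorm z.1 z.2)

/-- Under Kleppner's condition, a closed subspace of `ℓ²(Γ)` that is invariant under both regular
representations is trivial. -/
theorem KleppnerCondition.eq_bot_or_eq_top {σ : Multiplier Γ} (hσ : σ.KleppnerCondition)
    {Z : Submodule ℂ (lp (fun _ : Γ => ℂ) 2)} [Z.HasOrthogonalProjection]
    (hl : σ.leftRegular.Invariant Z) (hr : σ.rightRegular.Invariant Z) : Z = ⊥ ∨ Z = ⊤ := by
  set ξ := Z.starProjection (deltaOne Γ) with hξ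
  have hfix : ∀ a, σ.leftRegular.op a (σ.rightRegular.op a ξ) = ξ := fun a => by
    rw [hξ, ← SigmaRep.Intertwines.starProjection hr, ← SigmaRep.Intertwines.starProjection hl,
      leftRegular_rightRegular_deltaOne]
  -- The projection of `δ₁` is a multiple of `δ₁`, so `δ₁` lies in `Z` or in `Zᗮ`, and so does its
  -- whole `λ`-orbit.
  have hsmul : ξ = ξ 1 • deltaOne Γ := by
    ext y
    rw [lp.coeFn_smul, Pi.smul_apply, deltaOne_apply]
    split_ifs with hy
    · simp [hy]
    · simpa using hσ.eq_zero hfix hy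
  by_cases h0 : ξ 1 = 0
  · left
    rw [h0, zero_smul] at hsmul
    have hmem : deltaOne Γ ∈ Zᗮ := by
      simpa [← hξ, hsmul] using Z.sub_starProjection_mem_orthogonal (deltaOne Γ)
    refine (Submodule.eq_bot_iff _).mpr fun z hz => ?_
    ext a
    rw [← inner_leftRegular_deltaOne σ, lp.coeFn_zero, Pi.zero_apply]
    exact (Submodule.mem_orthogonal' _ _).mp (hl.orthogonal a _ hmem) z hz
  · right
    have hmem : deltaOne Γ ∈ Z := by
      rw [← Z.smul_mem_iff h0, ← hsmul]
      exact Z.starProjection_apply_mem _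
    refine Submodule.orthogonal_eq_bot_iff.mp ((Submodule.eq_bot_iff _).mpr fun z hz => ?_)
    ext a
    rw [← inner_leftRegular_deltaOne σ, lp.coeFn_zero, Pi.zero_apply]
    exact (Submodule.mem_orthogonal _ _).mp hz _ (hl a _ hmem)

end Multiplier

/-! ### Square-integrable representations -/

namespace SigmaRep

variable {Γ : Type*} [Group Γ] {σ : Multiplier Γ}
  {H : Type*} [NormedAddCommGroup H] [InnerProductSpace ℂ H] [CompleteSpace H]

/-- The coefficient map `f ↦ (⟨f, π(γ)g⟩)_γ` is a bounded operator into `ℓ²(Γ)` as soon as it takes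
values there. -/
theorem exists_coeffOperator (π : SigmaRep σ H) {g : H}
    (hg : ∀ f : H, Memℓp (π.matrixCoeff g f) 2) :
    ∃ C : H →L[ℂ] lp (fun _ : Γ => ℂ) 2, Intertwines π σ.leftRegular C ∧
      ∀ f γ, C f γ = inner ℂ (π.op γ g) f := by
  let C : H →ₗ[ℂ] lp (fun _ : Γ => ℂ) 2 :=
    { toFun := fun f => ⟨π.matrixCoeff g f, hg f⟩
      map_add' := fun f f' => by
        ext γ
        exact inner_add_right _ _ _
      map_smul' := fun a f => by
        ext γ
        exact inner_smul_right _ _ _ }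
  have hC : Continuous C := by
    -- Closed graph theorem: ℓ²-limits are pointwise limits, and each coefficient is continuous in
    -- the vector.
    refine C.continuous_of_seq_closed_graph fun u x y hu hy => ?_
    ext γ
    have h1 : Filter.Tendsto (fun n => C (u n) γ) Filter.atTop (nhds (y γ)) :=
      ((lp.lipschitzWith_one_eval 2 γ).continuous.tendsto y).comp hy
    have h2 : Filter.Tendsto (fun n => inner ℂ (π.op γ g) (u n)) Filter.atTop
        (nhds (inner ℂ (π.op γ g) x)) := tendsto_const_nhds.inner hu
    exact tendsto_nhds_unique h1 h2
  refine ⟨⟨C, hC⟩, fun a f => ?_, fun f γ => rfl⟩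
  ext γ
  rw [Multiplier.leftRegular_op_apply]
  change inner ℂ (π.op γ g) (π.op a f) = (σ a (a⁻¹ * γ) : ℂ) * inner ℂ (π.op (a⁻¹ * γ) g) f
  rw [← π.inner_op_op a (π.op (a⁻¹ * γ) g) f, op_op, mul_inv_cancel_left, inner_smul_left,
    ← mul_assoc, ← Circle.coe_inv_eq_conj, ← Circle.coe_mul, mul_inv_cancel, Circle.coe_one,
    one_mul]

/-- Under Kleppner's condition there is a nonzero intertwiner between any nonzero subrepresentation
of a square-integrable representation and any nonzero subrepresentation of the left regular one. -/
theorem exists_intertwines_leftRegular (π : SigmaRep σ H) (hπ : π.SquareIntegrable)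
    (hσ : σ.KleppnerCondition) (A : Submodule ℂ H) (B : Submodule ℂ (lp (fun _ : Γ => ℂ) 2))
    (hA : π.Invariant A) (hB : σ.leftRegular.Invariant B) (hA' : Aᗮ ≠ ⊥) (hB' : Bᗮ ≠ ⊥) :
    ∃ T : H →L[ℂ] lp (fun _ : Γ => ℂ) 2, Intertwines π σ.leftRegular T ∧ T ≠ 0 ∧
      (∀ x ∈ A, T x = 0) ∧ ∀ x, T x ∈ Bᗮ := by
  obtain ⟨D, hD, hmem⟩ := hπ
  obtain ⟨f, hf, hf0⟩ := Submodule.exists_mem_ne_zero_of_ne_bot hA'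
  obtain ⟨g, hg, hgf⟩ : ∃ g ∈ D, inner ℂ g f ≠ 0 := by
    by_contra! h
    exact hf0 (hD.eq_zero_of_inner_right (𝕜 := ℂ) h)
  obtain ⟨C, hC, hCf⟩ := π.exists_coeffOperator fun f => hmem f g hg
  have hCf0 : C f ≠ 0 := fun h => by
    have h1 := hCf f 1
    rw [h, op_one] at h1
    exact hgf h1.symm
  suffices ∃ b, Bᗮ.starProjection (σ.rightRegular.op b (C f)) ≠ 0 by
    obtain ⟨b, hb⟩ := this
    refine ⟨Bᗮ.starProjection ∘L σ.rightRegular.op b ∘L C ∘L Aᗮ.starProjection,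
      (Intertwines.starProjection hB.orthogonal).comp
        ((σ.intertwines_rightRegular b).comp
          (hC.comp (Intertwines.starProjection hA.orthogonal))), fun h => hb ?_, fun x hx => ?_,
      fun x => Submodule.starProjection_apply_mem _ _⟩
    · have h1 := congrArg (fun T : H →L[ℂ] lp (fun _ : Γ => ℂ) 2 => T f) h
      simpa [Submodule.starProjection_eq_self_iff.mpr hf] using h1
    · have h1 : Aᗮ.starProjection x = 0 :=
        (Submodule.starProjection_apply_eq_zero_iff _).mpr (A.le_orthogonal_orthogonal hx)
      simp [h1]
  by_contra! hall
  -- If every right translate of `C f` projected to zero, this closed biinvariant subspace would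
  -- contain `C f ≠ 0`, hence be everything, forcing `Bᗮ = ⊥`.
  let Z : Submodule ℂ (lp (fun _ : Γ => ℂ) 2) :=
    ⨅ b, LinearMap.ker (Bᗮ.starProjection ∘L σ.rightRegular.op b).toLinearMap
  have hZ : ∀ ξ, ξ ∈ Z ↔ ∀ b, Bᗮ.starProjection (σ.rightRegular.op b ξ) = 0 := fun ξ => by
    simp [Z]
  have hZc : IsClosed (Z : Set (lp (fun _ : Γ => ℂ) 2)) := by
    rw [Submodule.coe_iInf]
    exact isClosed_iInter fun b =>
      (Bᗮ.starProjection ∘L σ.rightRegular.op b).isClosed_ker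
  have : CompleteSpace Z := hZc.completeSpace_coe
  have hl : σ.leftRegular.Invariant Z := fun a ξ hξ => (hZ _).mpr fun b => by
    rw [σ.intertwines_rightRegular, Intertwines.starProjection hB.orthogonal, (hZ ξ).mp hξ,
      map_zero]
  have hr : σ.rightRegular.Invariant Z := fun a ξ hξ => (hZ _).mpr fun b => by
    rw [op_op, map_smul, (hZ ξ).mp hξ, smul_zero]
  rcases hσ.eq_bot_or_eq_top hl hr with h | h
  · have hmemZ : C f ∈ Z := (hZ _).mpr hall
    rw [h] at hmemZ
    exact hCf0 hmemZ
  · refine hB' ((Submodule.eq_bot_iff _).mpr fun ξ hξ => ?_)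
    have hξZ : ξ ∈ Z := h ▸ Submodule.mem_top
    have h1 := (hZ ξ).mp hξZ 1
    rwa [op_one, Submodule.starProjection_eq_self_iff.mpr hξ] at h1

/-- A subrepresentation of the left regular representation is cyclic. -/
theorem exists_isCyclicVector_of_isometry (π : SigmaRep σ H)
    (V : H →ₗᵢ[ℂ] lp (fun _ : Γ => ℂ) 2)
    (hV : Intertwines π σ.leftRegular V.toContinuousLinearMap) : ∃ g, π.IsCyclicVector g := by
  refine ⟨adjoint V.toContinuousLinearMap (Multiplier.deltaOne Γ), ?_⟩
  rw [IsCyclicVector, Submodule.topologicalClosure_eq_top_iff]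
  refine (Submodule.eq_bot_iff _).mpr fun f hf => ?_
  -- The coordinates of `V f` are the pairings of `f` with the orbit of `V†δ₁`.
  have h0 : V f = 0 := by
    ext γ
    rw [← Multiplier.inner_leftRegular_deltaOne σ]
    have h := (Submodule.mem_orthogonal _ _).mp hf _ (Submodule.subset_span ⟨γ, rfl⟩)
    change inner ℂ (π.op γ (adjoint V.toContinuousLinearMap (Multiplier.deltaOne Γ))) f = 0 at h
    rw [← hV.adjoint, adjoint_inner_left] at h
    exact h
  rw [← norm_eq_zero, ← V.norm_map, h0, norm_zero]

/-- If a square-integrable representation contains the left regular representation, then its double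
commutant has a separating vector. -/
theorem exists_isSeparatingVector_of_isometry (π : SigmaRep σ H) (hπ : π.SquareIntegrable)
    (W : lp (fun _ : Γ => ℂ) 2 →ₗᵢ[ℂ] H)
    (hW : Intertwines σ.leftRegular π W.toContinuousLinearMap) :
    ∃ g, IsSeparatingVector π.bicommutant g := by
  obtain ⟨D, hD, hmem⟩ := hπ
  refine ⟨W (Multiplier.deltaOne Γ), fun T hT hTg => ?_⟩
  refine ContinuousLinearMap.coeFn_injective
    (Continuous.ext_on hD T.continuous (0 : H →L[ℂ] H).continuous fun g hg => ?_)
  obtain ⟨C, hC, hCf⟩ := π.exists_coeffOperator fun f => hmem f g hg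
  have hWW : adjoint W.toContinuousLinearMap (W (Multiplier.deltaOne Γ)) =
      Multiplier.deltaOne Γ := by
    refine ext_inner_right ℂ fun ξ => ?_
    rw [adjoint_inner_left]
    exact W.inner_map_map _ _
  have hCg : adjoint C (Multiplier.deltaOne Γ) = g := by
    refine ext_inner_right ℂ fun f => ?_
    rw [adjoint_inner_left, Multiplier.inner_deltaOne, hCf, op_one]
  -- `C†W†` lies in the commutant and sends `Wδ₁` to `g`, so `T g = C†W†(T Wδ₁) = 0`.
  have hcomm := congrArg (fun S : H →L[ℂ] H => S (W (Multiplier.deltaOne Γ)))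
    (hT _ (hC.adjoint.comp hW.adjoint).mem_centralizer)
  change adjoint C (adjoint W.toContinuousLinearMap (T (W _))) =
    T (adjoint C (adjoint W.toContinuousLinearMap (W _))) at hcomm
  rw [hTg, map_zero, map_zero, hWW, hCg] at hcomm
  exact hcomm.symm

end SigmaRep

theorem mainTheorem5 {Γ : Type*} [Group Γ] [Countable Γ] (σ : Multiplier Γ)
    {H : Type*} [NormedAddCommGroup H] [InnerProductSpace ℂ H] [CompleteSpace H]
    [TopologicalSpace.SeparableSpace H]
    (π : SigmaRep σ H) (hπ : π.SquareIntegrable) (hσ : σ.KleppnerCondition) :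
    (∃ g : H, π.IsCyclicVector g) ∨ (∃ g : H, IsSeparatingVector π.bicommutant g) := by
  rcases SigmaRep.exists_isometry_or_exists_isometry π σ.leftRegular
    (π.exists_intertwines_leftRegular hπ hσ) with ⟨V, hV⟩ | ⟨W, hW⟩
  · exact Or.inl (π.exists_isCyclicVector_of_isometry V hV)
  · exact Or.inr (π.exists_isSeparatingVector_of_isometry hπ W hW)
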